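/- Let $\mathsf G$ be a connected metric graph consisting of $E\ge 1$ edges of finite positive lengths (loops and multiple edges are allowed), and let $L>0$ be its total length, i.e. the sum of the edge lengths. Consider the Laplacian $\Delta$ acting as the second derivative on each edge, on functions that are $H^2$ on each edge, continuous at the vertices, and satisfy the Kirchhoff condition that at each vertex the derivatives in the directions into the incident edges sum to $0$ (a loop contributing both of its ends). The spectral gap $\lambda_1(\mathsf G)$ is the smallest positive eigenvalue of $-\Delta$, which exists. Call $\mathsf G$ a flower if it has exactly one vertex (so that all edges are loops), a pumpkin if it has exactly two vertices and every edge joins these two vertices, and equilateral if all edges have the same length; here flowers and pumpkins are not required to be equilateral. (i) If $E\ge 2$, then $$\lambda_1(\mathsf G)\le \frac{\pi^2E^2}{L^2}.$$ (ii) If $E\ge 3$, equality holds in (i) if and only if $\mathsf G$ is an equilateral pumpkin or an equilateral flower. If $E=2$, equality holds in (i) if and only if $\mathsf G$ is a pumpkin or a flower, the two edges having arbitrary lengths. (iii) If $E=1$, then $\lambda_1(\mathsf G)=4\pi^2/L^2$ if $\mathsf G$ is a loop (the edge has equal endpoints) and $\lambda_1(\mathsf G)=\pi^2/L^2$ if $\mathsf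 G$ is a path (the edge has distinct endpoints). -/

import Mathlib

open MeasureTheory Set

/-- A metric graph with vertex set `V` and edge set `E`; loops and multiple edges are allowed.
The edge `e` is identified with the interval `[0, len e]`, the endpoint `0` being glued to the
vertex `src e` and the endpoint `len e` to the vertex `tgt e` (the orientation is only used for
parametrising the edge). -/
structure MetricGraph (V E : Type*) where
  src : E → V
  tgt : E → V
  len : E → ℝ
  len_pos : ∀ e, 0 < len e

namespace MetricGraph

variable {V E : Type*}

/-- Connectedness of the graph (and non-emptiness). Loops and multiplicities of edges play no role
here, so this is connectedness of the underlying simple graph on the vertices. -/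
def Connected (G : MetricGraph V E) : Prop :=
  (SimpleGraph.fromRel fun v w : V => ∃ e, G.src e = v ∧ G.tgt e = w).Connected

/-- The total length. -/
def totalLength [Fintype E] (G : MetricGraph V E) : ℝ := ∑ e, G.len e

/-- All edges have the same length. -/
def Equilateral (G : MetricGraph V E) : Prop := ∀ e e', G.len e = G.len e'

/-- A (not necessarily equilateral) flower: exactly one vertex, so that every edge is a loop. -/
def IsFlower (G : MetricGraph V E) : Prop :=
  ∃ v : V, (∀ x : V, x = v) ∧ ∀ e, G.src e = v ∧ G.tgt e = v

/-- A (not necessarily equilateral) pumpkin: exactly two vertices, and every edge joins them. -/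
def IsPumpkin (G : MetricGraph V E) : Prop :=
  ∃ v w : V, v ≠ w ∧ (∀ x : V, x = v ∨ x = w) ∧
    ∀ e, (G.src e = v ∧ G.tgt e = w) ∨ (G.src e = w ∧ G.tgt e = v)

/-- `f` is (the `C¹` representative of) a function in the Sobolev space `H²(0, ℓ)`, with first
derivative `f'` and second derivative `f''`: the function `f''` is in `L²(0, ℓ)`, `f'` is an
antiderivative of `f''`, and `f` is an antiderivative of `f'`. The values of `f` and `f'` at the
endpoints are the boundary values. -/
structure IsH2 (ℓ : ℝ) (f f' f'' : ℝ → ℝ) : Prop where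
  memLp : MemLp f'' 2 (volume.restrict (Icc 0 ℓ))
  deriv_eq : ∀ x ∈ Icc (0 : ℝ) ℓ, f' x = f' 0 + ∫ t in (0 : ℝ)..x, f'' t
  eq : ∀ x ∈ Icc (0 : ℝ) ℓ, f x = f 0 + ∫ t in (0 : ℝ)..x, f' t

/-- The sum, over all edge ends at the vertex `v`, of the derivatives at `v` of a function with
edgewise derivative `f'`, taken in the direction from `v` into the edge. Both ends of a loop
contribute. -/
noncomputable def normalDerivSum [Fintype E] (G : MetricGraph V E) (f' : E → ℝ → ℝ) (v : V) : ℝ :=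
  open Classical in
  ∑ e, ((if G.src e = v then f' e 0 else 0) - (if G.tgt e = v then f' e (G.len e) else 0))

/-- `f` is in the domain of the Laplacian `Δ` on `G` with natural (continuity and Kirchhoff) vertex
conditions, and `-Δ f = g`. -/
def IsNegLaplacian [Fintype E] (G : MetricGraph V E) (f g : E → ℝ → ℝ) : Prop :=
  ∃ f' : E → ℝ → ℝ,
    (∀ e, IsH2 (G.len e) (f e) (f' e) (fun x => -g e x)) ∧
    (∃ φ : V → ℝ, ∀ e, f e 0 = φ (G.src e) ∧ f e (G.len e) = φ (G.tgt e)) ∧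
    ∀ v, G.normalDerivSum f' v = 0

/-- `μ` is an eigenvalue of `-Δ`: some function `f` in the domain, not identically zero on the
graph, satisfies `-Δ f = μ f`. -/
def IsEigenvalue [Fintype E] (G : MetricGraph V E) (μ : ℝ) : Prop :=
  ∃ f : E → ℝ → ℝ, (∃ e, ∃ x ∈ Icc 0 (G.len e), f e x ≠ 0) ∧
    G.IsNegLaplacian f (fun e x => μ * f e x)

/-- The set of positive eigenvalues of `-Δ`. -/
def posEigenvalues [Fintype E] (G : MetricGraph V E) : Set ℝ := {μ | 0 < μ ∧ G.IsEigenvalue μ}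

/-- The spectral gap `λ₁`: the lowest non-trivial eigenvalue of `-Δ`. -/
noncomputable def spectralGap [Fintype E] (G : MetricGraph V E) : ℝ := sInf G.posEigenvalues

end MetricGraph

/-! ### Eigenfunctions in trigonometric form. -/

namespace MetricGraph

variable {V E : Type*}

/-! Halve every edge. While `k * len e < 2π`, a solution of `-f'' = k² f` on a half edge is
determined by its end values, so `k²` is an eigenvalue iff the finite-dimensional form `form k` is
degenerate (`isEigenvalue_sq_iff_form`). Maximising `form k` over the shifts `p + c • 1` and
multiplying by `mean k 1` gives `redForm k`, a form modulo constants that is positive definite at `k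
= 0` because `G` is connected. Hence the least `k` at which it fails to be positive definite modulo
constants is the square root of the spectral gap (`exists_isLeast_posEigenvalues`).

Let `l₁ ≥ l₂` be the two largest lengths and `K = 2π / (l₁ + l₂)`. Cosine bumps of opposite signs on
these two edges have matching end values at frequency `K`, and they give a nonconstant vector on
which `redForm K` is nonpositive. So the gap is at most `K²`, and `L ≤ l₁ + (E - 1) l₂ ≤ E (l₁ + l₂)
/ 2` yields the bound.

Equality makes the test vector an isotropic vector of a semidefinite form, so it satisfies the
Kirchhoff conditions, and these make the two edges parallel. If `E ≥ 3`, equality also forces all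
lengths to agree, so every edge is parallel to the longest one. Conversely, the vertex conditions of
a pumpkin or flower split into even and odd linear systems, which have no nonzero solution below the
claimed frequency. -/

theorem IsH2.continuousOn_deriv {ℓ : ℝ} (hℓ : 0 ≤ ℓ) {f f' f'' : ℝ → ℝ} (h : IsH2 ℓ f f' f'') :
    ContinuousOn f' (Icc 0 ℓ) := by
  have hint : IntegrableOn f'' (uIcc 0 ℓ) := by
    rw [uIcc_of_le hℓ]
    exact h.memLp.integrable one_le_two
  have := (intervalIntegral.continuousOn_primitive_interval hint).const_add (f' 0)
  rw [uIcc_of_le hℓ] at this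
  exact this.congr h.deriv_eq

theorem hasDerivWithinAt_of_eq_integral {ℓ : ℝ} (hℓ : 0 ≤ ℓ) {f g : ℝ → ℝ}
    (hg : ContinuousOn g (Icc 0 ℓ))
    (hf : ∀ x ∈ Icc (0 : ℝ) ℓ, f x = f 0 + ∫ t in (0 : ℝ)..x, g t) {x : ℝ} (hx : x ∈ Icc 0 ℓ) :
    HasDerivWithinAt f (g x) (Icc 0 ℓ) x := by
  set G : ℝ → ℝ := IccExtend hℓ ((Icc 0 ℓ).domRestrict g) with hG
  have hGc : Continuous G := (continuousOn_iff_continuous_domRestrict.1 hg).Icc_extend'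
  have hGg : ∀ t ∈ Icc 0 ℓ, G t = g t := fun t ht => by
    rw [hG, IccExtend_of_mem _ _ ht, domRestrict_apply]
  have hd : HasDerivAt (fun y => f 0 + ∫ t in (0 : ℝ)..y, G t) (G x) x :=
    (intervalIntegral.integral_hasDerivAt_right (hGc.intervalIntegrable _ _)
      hGc.aestronglyMeasurable.stronglyMeasurableAtFilter hGc.continuousAt).const_add _
  rw [hGg x hx] at hd
  have key : ∀ y ∈ Icc 0 ℓ, f y = f 0 + ∫ t in (0 : ℝ)..y, G t := fun y hy => by
    rw [hf y hy]
    congr 1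
    refine intervalIntegral.integral_congr fun t ht => (hGg t ?_).symm
    rw [uIcc_of_le hy.1] at ht
    exact ⟨ht.1, ht.2.trans hy.2⟩
  exact hd.hasDerivWithinAt.congr key (key x hx)

/-- Solutions of `-f'' = k² f` are trigonometric; the phase is centred at an arbitrary `h`. -/
theorem IsH2.eq_trig {ℓ k : ℝ} (hℓ : 0 ≤ ℓ) (hk : 0 < k) (h : ℝ) {f f' : ℝ → ℝ}
    (H : IsH2 ℓ f f' (fun x => -(k ^ 2 * f x))) :
    ∃ A B : ℝ, ∀ x ∈ Icc 0 ℓ,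
      f x = A * Real.cos (k * (x - h)) + B * Real.sin (k * (x - h)) ∧
      f' x = k * (-A * Real.sin (k * (x - h)) + B * Real.cos (k * (x - h))) := by
  have hf'c := H.continuousOn_deriv hℓ
  have hf : ∀ x ∈ Icc 0 ℓ, HasDerivWithinAt f (f' x) (Icc 0 ℓ) x :=
    fun x hx => hasDerivWithinAt_of_eq_integral hℓ hf'c H.eq hx
  have hfc : ContinuousOn f (Icc 0 ℓ) := fun x hx => (hf x hx).continuousWithinAt
  have hf' : ∀ x ∈ Icc 0 ℓ, HasDerivWithinAt f' (-(k ^ 2 * f x)) (Icc 0 ℓ) x :=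
    fun x hx => hasDerivWithinAt_of_eq_integral hℓ (hfc.const_mul _ |>.neg) H.deriv_eq hx
  have hlin : ∀ x, HasDerivAt (fun x => k * (x - h)) k x := fun x => by
    simpa using ((hasDerivAt_id x).sub_const h).const_mul k
  have hcos := fun x => (hlin x).cos
  have hsin := fun x => (hlin x).sin
  have const : ∀ F : ℝ → ℝ, (∀ x ∈ Icc 0 ℓ, HasDerivWithinAt F 0 (Icc 0 ℓ) x) →
      ∀ x ∈ Icc 0 ℓ, F x = F 0 := fun F hF =>
    constant_of_has_deriv_right_zero (fun x hx => (hF x hx).continuousWithinAt)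
      fun x hx => (hF x (Ico_subset_Icc_self hx)).mono_of_mem_nhdsWithin
        (Icc_mem_nhdsGE_of_mem hx)
  -- Rotating `(k f, f')` back by the angle `k (x - h)` gives two conserved quantities, `k A` and `k
  -- B`.
  have hA := const (fun x => k * f x * Real.cos (k * (x - h)) - f' x * Real.sin (k * (x - h)))
    fun x hx => (((hf x hx).const_mul k).mul (hcos x).hasDerivWithinAt |>.sub
      ((hf' x hx).mul (hsin x).hasDerivWithinAt)).congr_deriv (by ring)
  have hB := const (fun x => k * f x * Real.sin (k * (x - h)) + f' x * Real.cos (k * (x - h)))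
    fun x hx => (((hf x hx).const_mul k).mul (hsin x).hasDerivWithinAt |>.add
      ((hf' x hx).mul (hcos x).hasDerivWithinAt)).congr_deriv (by ring)
  refine ⟨(k * f 0 * Real.cos (k * (0 - h)) - f' 0 * Real.sin (k * (0 - h))) / k,
    (k * f 0 * Real.sin (k * (0 - h)) + f' 0 * Real.cos (k * (0 - h))) / k, fun x hx => ?_⟩
  rw [← hA x hx, ← hB x hx]
  have h1 := Real.sin_sq_add_cos_sq (k * (x - h))
  constructor
  · field_simp
    linear_combination (-k * f x) * h1
  · field_simp
    linear_combination (-f' x) * h1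

theorem isH2_trig {ℓ k : ℝ} (A B h : ℝ) :
    IsH2 ℓ (fun x => A * Real.cos (k * (x - h)) + B * Real.sin (k * (x - h)))
      (fun x => k * (-A * Real.sin (k * (x - h)) + B * Real.cos (k * (x - h))))
      (fun x => -(k ^ 2 * (A * Real.cos (k * (x - h)) + B * Real.sin (k * (x - h))))) := by
  have hlin : ∀ x, HasDerivAt (fun x => k * (x - h)) k x := fun x => by
    simpa using ((hasDerivAt_id x).sub_const h).const_mul k
  have hcos := fun x => (hlin x).cos
  have hsin := fun x => (hlin x).sin
  refine ⟨?_, fun x _ => ?_, fun x _ => ?_⟩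
  · refine MemLp.of_bound (Continuous.aestronglyMeasurable (by fun_prop))
      (k ^ 2 * (|A| + |B|)) (Filter.Eventually.of_forall fun x => ?_)
    rw [norm_neg, norm_mul, Real.norm_of_nonneg (sq_nonneg k)]
    refine mul_le_mul_of_nonneg_left ((norm_add_le _ _).trans (add_le_add ?_ ?_)) (sq_nonneg k)
    · rw [norm_mul]
      exact mul_le_of_le_one_right (abs_nonneg _) (Real.abs_cos_le_one _)
    · rw [norm_mul]
      exact mul_le_of_le_one_right (abs_nonneg _) (Real.abs_sin_le_one _)
  · rw [intervalIntegral.integral_eq_sub_of_hasDerivAt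
      (f := fun x => k * (-A * Real.sin (k * (x - h)) + B * Real.cos (k * (x - h))))
      (fun x _ => ((((hsin x).const_mul (-A)).add ((hcos x).const_mul B)).const_mul k).congr_deriv
        (by ring)) (Continuous.intervalIntegrable (by fun_prop) _ _)]
    ring
  · rw [intervalIntegral.integral_eq_sub_of_hasDerivAt
      (f := fun x => A * Real.cos (k * (x - h)) + B * Real.sin (k * (x - h)))
      (fun x _ => (((hcos x).const_mul A).add ((hsin x).const_mul B)).congr_deriv
        (by ring)) (Continuous.intervalIntegrable (by fun_prop) _ _)]
    ring

/-- The phase at frequency `k` between the midpoint of an edge and its endpoints. -/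
noncomputable def phase (G : MetricGraph V E) (k : ℝ) (e : E) : ℝ := k * (G.len e / 2)

open Classical in
/-- `k²` is an eigenvalue iff there are coefficients `A e`, `B e` such that the function
`A e cos (k (x - len e / 2)) + B e sin (k (x - len e / 2))` satisfies the vertex conditions. -/
theorem isEigenvalue_sq_iff [Fintype E] (G : MetricGraph V E) {k : ℝ} (hk : 0 < k) :
    G.IsEigenvalue (k ^ 2) ↔ ∃ A B : E → ℝ, (∃ e, A e ≠ 0 ∨ B e ≠ 0) ∧
      (∃ φ : V → ℝ, ∀ e,
        A e * Real.cos (G.phase k e) - B e * Real.sin (G.phase k e) = φ (G.src e) ∧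
        A e * Real.cos (G.phase k e) + B e * Real.sin (G.phase k e) = φ (G.tgt e)) ∧
      ∀ v, ∑ e, ((if G.src e = v then
          A e * Real.sin (G.phase k e) + B e * Real.cos (G.phase k e) else 0) +
        (if G.tgt e = v then
          A e * Real.sin (G.phase k e) - B e * Real.cos (G.phase k e) else 0)) = 0 := by
  have h0 : ∀ e, k * (0 - G.len e / 2) = -G.phase k e := fun e => by rw [phase]; ring
  have h1 : ∀ e, k * (G.len e - G.len e / 2) = G.phase k e := fun e => by rw [phase]; ring
  constructor
  · rintro ⟨f, ⟨e₀, x₀, hx₀, hne⟩, f', hH, ⟨φ, hφ⟩, hK⟩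
    choose A B hAB using fun e => (hH e).eq_trig (G.len_pos e).le hk (G.len e / 2)
    have hl := fun e => left_mem_Icc.2 (G.len_pos e).le
    have hr := fun e => right_mem_Icc.2 (G.len_pos e).le
    refine ⟨A, B, ⟨e₀, ?_⟩, ⟨φ, fun e => ⟨?_, ?_⟩⟩, fun v => ?_⟩
    · contrapose! hne
      rw [(hAB e₀ x₀ hx₀).1, hne.1, hne.2]
      ring
    · rw [← (hφ e).1, (hAB e 0 (hl e)).1, h0, Real.cos_neg, Real.sin_neg]
      ring
    · rw [← (hφ e).2, (hAB e _ (hr e)).1, h1]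
    · rw [← mul_right_inj' hk.ne', mul_zero, Finset.mul_sum]
      refine Eq.trans ?_ (hK v)
      refine Finset.sum_congr rfl fun e _ => ?_
      rw [(hAB e 0 (hl e)).2, (hAB e _ (hr e)).2, h0, h1, Real.cos_neg, Real.sin_neg]
      split_ifs <;> ring
  · rintro ⟨A, B, ⟨e₀, hne⟩, ⟨φ, hφ⟩, hK⟩
    refine ⟨fun e x => A e * Real.cos (k * (x - G.len e / 2)) +
      B e * Real.sin (k * (x - G.len e / 2)), ?_, fun e x =>
      k * (-A e * Real.sin (k * (x - G.len e / 2)) + B e * Real.cos (k * (x - G.len e / 2))),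
      fun e => isH2_trig _ _ _, ⟨φ, fun e => ⟨?_, ?_⟩⟩, fun v => ?_⟩
    · by_contra! hz
      refine hne.elim ?_ ?_ <;> apply not_not_intro
      · simpa using hz e₀ (G.len e₀ / 2) ⟨by linarith [G.len_pos e₀], by linarith [G.len_pos e₀]⟩
      · have hl := G.len_pos e₀
        have hA : A e₀ = 0 := by
          simpa using hz e₀ (G.len e₀ / 2) ⟨by linarith, by linarith⟩
        -- The midpoint only detects `A`. A nearby point with `0 < k t ≤ 1 < π` detects `B`.
        set t := min (G.len e₀ / 2) (1 / k) with ht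
        have htp : 0 < t := lt_min (by linarith) (by positivity)
        have hkt : k * t ≤ 1 := by
          calc k * t ≤ k * (1 / k) := by gcongr; exact min_le_right _ _
            _ = 1 := by field_simp
        have := hz e₀ (G.len e₀ / 2 + t)
          ⟨by linarith, by linarith [min_le_left (G.len e₀ / 2) (1 / k)]⟩
        rw [hA, zero_mul, zero_add, add_sub_cancel_left, mul_eq_zero] at this
        exact this.resolve_right (Real.sin_pos_of_pos_of_lt_pi (by positivity)
          (hkt.trans_lt (by linarith [Real.pi_gt_three]))).ne'
    · rw [← (hφ e).1]
      simp only [h0, Real.cos_neg, Real.sin_neg]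
      ring
    · rw [← (hφ e).2]
      simp only [h1]
    · refine Eq.trans ?_ ((congrArg (k * ·) (hK v)).trans (mul_zero k))
      rw [normalDerivSum, Finset.mul_sum]
      refine Finset.sum_congr rfl fun e _ => ?_
      simp only [h0, h1, Real.cos_neg, Real.sin_neg]
      split_ifs <;> ring

end MetricGraph

/-! ### The coefficients of a half edge. -/

theorem Real.sinc_mul_self (x : ℝ) : Real.sinc x * x = Real.sin x := by
  rcases eq_or_ne x 0 with rfl | hx
  · simp
  · rw [Real.sinc_of_ne_zero hx, div_mul_cancel₀ _ hx]

theorem Real.sinc_pos_of_nonneg_of_lt_pi {x : ℝ} (h0 : 0 ≤ x) (h1 : x < Real.pi) :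
    0 < Real.sinc x := by
  rcases h0.eq_or_lt with rfl | h0
  · simp
  · rw [Real.sinc_of_ne_zero h0.ne']
    exact div_pos (Real.sin_pos_of_pos_of_lt_pi h0 h1) h0

namespace MetricGraph

variable {V E : Type*}

section Coefficients

variable (G : MetricGraph V E) (k : ℝ) (e : E)

/-- The conductance `k / sin (k len e / 2)` of half of the edge `e`, extended continuously to
`k = 0`. -/
noncomputable def conductance : ℝ := (G.len e / 2 * Real.sinc (G.phase k e))⁻¹

/-- The mass `tan (k len e / 4) / k` that each end of half of the edge `e` carries, extended
continuously to `k = 0`. -/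
noncomputable def mass : ℝ :=
  G.conductance k e * ((G.len e / 2) ^ 2 / 2 * Real.sinc (G.phase k e / 2) ^ 2)

theorem sq_mul_mass :
    k ^ 2 * G.mass k e = G.conductance k e * (1 - Real.cos (G.phase k e)) := by
  have h := Real.sinc_mul_self (G.phase k e / 2)
  have h2 : Real.cos (G.phase k e) = 1 - 2 * Real.sin (G.phase k e / 2) ^ 2 := by
    have := Real.cos_sq' (G.phase k e / 2)
    have h3 := Real.cos_two_mul (G.phase k e / 2)
    rw [mul_div_cancel₀ _ two_ne_zero] at h3
    linarith
  rw [h2, ← h, mass]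
  simp only [phase]
  ring

variable {G k e}

theorem phase_nonneg (hk : 0 ≤ k) : 0 ≤ G.phase k e :=
  mul_nonneg hk (half_pos (G.len_pos e)).le

theorem phase_pos (hk : 0 < k) : 0 < G.phase k e := mul_pos hk (half_pos (G.len_pos e))

theorem phase_lt_pi (h : k * G.len e < 2 * Real.pi) : G.phase k e < Real.pi := by
  rw [phase]; linarith

theorem sin_phase_pos (hk : 0 < k) (h : k * G.len e < 2 * Real.pi) :
    0 < Real.sin (G.phase k e) :=
  Real.sin_pos_of_pos_of_lt_pi (phase_pos hk) (phase_lt_pi h)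

theorem sinc_phase_pos (hk : 0 ≤ k) (h : k * G.len e < 2 * Real.pi) :
    0 < Real.sinc (G.phase k e) :=
  Real.sinc_pos_of_nonneg_of_lt_pi (phase_nonneg hk) (phase_lt_pi h)

theorem conductance_pos (hk : 0 ≤ k) (h : k * G.len e < 2 * Real.pi) :
    0 < G.conductance k e :=
  inv_pos.2 (mul_pos (half_pos (G.len_pos e)) (sinc_phase_pos hk h))

theorem mass_pos (hk : 0 ≤ k) (h : k * G.len e < 2 * Real.pi) : 0 < G.mass k e := by
  have h1 := phase_nonneg (G := G) (e := e) hk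
  have h2 := phase_lt_pi h
  have := Real.sinc_pos_of_nonneg_of_lt_pi (x := G.phase k e / 2) (by linarith) (by linarith)
  have := G.len_pos e
  exact mul_pos (conductance_pos hk h) (by positivity)

theorem conductance_mul_sin (hk : 0 ≤ k) (h : k * G.len e < 2 * Real.pi) :
    G.conductance k e * Real.sin (G.phase k e) = k := by
  have h1 := (sinc_phase_pos hk h).ne'
  have := (G.len_pos e).ne'
  rw [← Real.sinc_mul_self, conductance, mul_inv, mul_assoc, inv_mul_cancel_left₀ h1]
  simp only [phase]
  field_simp

end Coefficients

/-! ### The discretised quadratic form and its kernel. -/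

section Forms

variable [Fintype E] (G : MetricGraph V E) (k : ℝ)

/-- The quadratic form `∫ f'² - k² f²`, polarised, on the functions that satisfy `-f'' = k² f` on
each half of an edge, expressed through the values at the vertices and at the midpoints of the
edges. -/
noncomputable def form (p q : (V → ℝ) × (E → ℝ)) : ℝ :=
  ∑ e, G.conductance k e *
    ((p.1 (G.src e) * q.1 (G.src e) + p.1 (G.tgt e) * q.1 (G.tgt e) + 2 * (p.2 e * q.2 e)) *
      Real.cos (G.phase k e) - p.2 e * (q.1 (G.src e) + q.1 (G.tgt e)) -
      q.2 e * (p.1 (G.src e) + p.1 (G.tgt e)))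

/-- The integral of the function that satisfies `-f'' = k² f` on each half of an edge, expressed
through the values at the vertices and at the midpoints of the edges. -/
noncomputable def mean (p : (V → ℝ) × (E → ℝ)) : ℝ :=
  ∑ e, G.mass k e * (p.1 (G.src e) + p.1 (G.tgt e) + 2 * p.2 e)

/-- The form `G.form k`, reduced so as to be invariant under the addition of constants. -/
noncomputable def redForm (p q : (V → ℝ) × (E → ℝ)) : ℝ :=
  G.mean k 1 * G.form k p q + k ^ 2 * (G.mean k p * G.mean k q)

theorem form_comm (p q : (V → ℝ) × (E → ℝ)) : G.form k p q = G.form k q p :=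
  Finset.sum_congr rfl fun e _ => by ring

theorem form_add_smul (p q r : (V → ℝ) × (E → ℝ)) (t : ℝ) :
    G.form k (p + t • q) r = G.form k p r + t * G.form k q r := by
  simp only [form, Finset.mul_sum, ← Finset.sum_add_distrib]
  refine Finset.sum_congr rfl fun e _ => ?_
  simp only [Prod.fst_add, Prod.snd_add, Prod.smul_fst, Prod.smul_snd, Pi.add_apply, Pi.smul_apply,
    smul_eq_mul]
  ring

theorem mean_add_smul (p q : (V → ℝ) × (E → ℝ)) (t : ℝ) :
    G.mean k (p + t • q) = G.mean k p + t * G.mean k q := by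
  simp only [mean, Finset.mul_sum, ← Finset.sum_add_distrib]
  refine Finset.sum_congr rfl fun e _ => ?_
  simp only [Prod.fst_add, Prod.snd_add, Prod.smul_fst, Prod.smul_snd, Pi.add_apply, Pi.smul_apply,
    smul_eq_mul]
  ring

/-- This identity puts the vector `1` in the kernel of `redForm` and makes kernel vectors of `form`
have mean zero when `k ≠ 0`. -/
theorem form_one_left (p : (V → ℝ) × (E → ℝ)) : G.form k 1 p = -(k ^ 2 * G.mean k p) := by
  simp only [form, mean, Finset.mul_sum, ← Finset.sum_neg_distrib, ← mul_assoc, sq_mul_mass]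
  refine Finset.sum_congr rfl fun e _ => ?_
  simp only [Prod.fst_one, Prod.snd_one, Pi.one_apply]
  ring

theorem redForm_comm (p q : (V → ℝ) × (E → ℝ)) : G.redForm k p q = G.redForm k q p := by
  rw [redForm, redForm, form_comm, mul_comm (G.mean k p)]

theorem redForm_add_smul (p q r : (V → ℝ) × (E → ℝ)) (t : ℝ) :
    G.redForm k (p + t • q) r = G.redForm k p r + t * G.redForm k q r := by
  rw [redForm, redForm, redForm, form_add_smul, mean_add_smul]
  ring

theorem redForm_add_smul_self (p q : (V → ℝ) × (E → ℝ)) (t : ℝ) :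
    G.redForm k (p + t • q) (p + t • q) =
      G.redForm k p p + 2 * t * G.redForm k p q + t ^ 2 * G.redForm k q q := by
  rw [redForm_add_smul, redForm_comm, redForm_add_smul, redForm_comm G k q (p + _),
    redForm_add_smul, redForm_comm G k q p]
  ring

theorem redForm_one_left (p : (V → ℝ) × (E → ℝ)) : G.redForm k 1 p = 0 := by
  rw [redForm, form_one_left]
  ring

theorem redForm_add_const (p : (V → ℝ) × (E → ℝ)) (t : ℝ) :
    G.redForm k (p + t • 1) (p + t • 1) = G.redForm k p p := by
  rw [redForm_add_smul_self, redForm_comm G k p 1, redForm_one_left, redForm_one_left]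
  ring

theorem redForm_smul_self (p : (V → ℝ) × (E → ℝ)) (t : ℝ) :
    G.redForm k (t • p) (t • p) = t ^ 2 * G.redForm k p p := by
  have h := redForm_add_smul_self G k 0 p t
  have h0 : ∀ q, G.redForm k 0 q = 0 := fun q => by simp [redForm, form, mean]
  rw [h0, h0, zero_add] at h
  rw [h]
  ring

variable {G k}

theorem mean_one_pos [Nonempty E] (hk : 0 ≤ k) (h : ∀ e, k * G.len e < 2 * Real.pi) :
    0 < G.mean k 1 :=
  Finset.sum_pos (fun e _ => mul_pos (mass_pos hk (h e)) (by norm_num [Prod.fst_one, Prod.snd_one]))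
    Finset.univ_nonempty

/-- A positive semidefinite form vanishes on its isotropic vectors. -/
theorem redForm_eq_zero_of_nonneg (hnn : ∀ q, 0 ≤ G.redForm k q q) {p : (V → ℝ) × (E → ℝ)}
    (hp : G.redForm k p p ≤ 0) (q : (V → ℝ) × (E → ℝ)) : G.redForm k p q = 0 := by
  have h := discrim_le_zero (a := G.redForm k q q) (b := 2 * G.redForm k p q)
    (c := G.redForm k p p) fun t => by
      have := hnn (p + t • q)
      rw [redForm_add_smul_self] at this
      linarith
  rw [discrim, le_antisymm hp (hnn p), mul_zero, sub_zero] at h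
  simpa using pow_eq_zero_iff two_ne_zero |>.1 (le_antisymm h (sq_nonneg _))

theorem form_eq_zero_of_redForm [Nonempty E] (hk : 0 ≤ k) (h : ∀ e, k * G.len e < 2 * Real.pi)
    {p : (V → ℝ) × (E → ℝ)} (hp : ∀ q, G.redForm k p q = 0) :
    ∃ c : ℝ, ∀ q, G.form k (p + c • 1) q = 0 := by
  have hW := mean_one_pos hk h
  -- The shift that makes the mean vanish; the rank-one term of `redForm` then drops out.
  refine ⟨-G.mean k p / G.mean k 1, fun q => ?_⟩
  rw [form_add_smul, form_one_left]
  have := hp q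
  rw [redForm] at this
  field_simp
  linarith

open Classical in
/-- The Kirchhoff conditions at the midpoints and at the vertices, for a vector in the kernel of
the form. -/
theorem kirchhoff_of_form_eq_zero (hk : 0 ≤ k) (h : ∀ e, k * G.len e < 2 * Real.pi)
    {p : (V → ℝ) × (E → ℝ)} (hp : ∀ q, G.form k p q = 0) :
    (∀ e, p.1 (G.src e) + p.1 (G.tgt e) = 2 * p.2 e * Real.cos (G.phase k e)) ∧
    ∀ v, ∑ e, G.conductance k e * ((if G.src e = v then
        p.2 e - p.1 (G.src e) * Real.cos (G.phase k e) else 0) + (if G.tgt e = v then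
        p.2 e - p.1 (G.tgt e) * Real.cos (G.phase k e) else 0)) = 0 := by
  constructor
  · intro e
    have := hp (0, Pi.single e 1)
    rw [form, Finset.sum_eq_single e] at this
    · have h2 := (mul_eq_zero.1 this).resolve_left (conductance_pos hk (h e)).ne'
      simp at h2
      linarith
    · intro e' _ hne
      simp [hne]
    · simp
  · intro v
    refine neg_eq_zero.1 (Eq.trans ?_ (hp (Pi.single v 1, 0)))
    rw [form, ← Finset.sum_neg_distrib]
    refine Finset.sum_congr rfl fun e _ => ?_
    simp only [Pi.single_apply, Pi.zero_apply]
    split_ifs <;> ring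

/-- `k²` is an eigenvalue iff the form is degenerate. -/
theorem isEigenvalue_sq_iff_form (hk : 0 < k) (h : ∀ e, k * G.len e < 2 * Real.pi)
    (hV : ∀ v, ∃ e, G.src e = v ∨ G.tgt e = v) :
    G.IsEigenvalue (k ^ 2) ↔ ∃ p ≠ 0, ∀ q, G.form k p q = 0 := by
  rw [isEigenvalue_sq_iff G hk]
  have hg := fun e => conductance_mul_sin hk.le (h e)
  have hs := fun e => sin_phase_pos hk (h e)
  have hcs := fun e => Real.sin_sq_add_cos_sq (G.phase k e)
  constructor
  · rintro ⟨A, B, ⟨e₀, he₀⟩, ⟨φ, hφ⟩, hK⟩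
    refine ⟨(φ, A), ?_, fun q => ?_⟩
    · intro hp
      rw [Prod.mk_eq_zero] at hp
      obtain ⟨h1, h2⟩ := hφ e₀
      simp only [hp.1, hp.2, Pi.zero_apply, zero_mul] at h1 h2 he₀
      exact he₀.elim (fun h => h rfl) fun hB => mul_ne_zero hB (hs e₀).ne' (by linarith)
    · classical
      have key : G.form k (φ, A) q = -∑ e, ∑ v ∈ {G.src e, G.tgt e}, k * q.1 v *
          ((if G.src e = v then
            A e * Real.sin (G.phase k e) + B e * Real.cos (G.phase k e) else 0) +
          (if G.tgt e = v then
            A e * Real.sin (G.phase k e) - B e * Real.cos (G.phase k e) else 0)) := by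
        rw [form, ← Finset.sum_neg_distrib]
        refine Finset.sum_congr rfl fun e _ => ?_
        have h1 := (hφ e).1
        have h2 := (hφ e).2
        simp only
        rw [← h1, ← h2]
        -- For a loop the set of endpoints collapses to one element, and continuity kills the odd
        -- coefficient.
        by_cases hl : G.src e = G.tgt e
        · have hB : B e = 0 := by
            rw [hl, ← h2] at h1
            have : B e * Real.sin (G.phase k e) = 0 := by linarith
            exact (mul_eq_zero.1 this).resolve_right (hs e).ne'
          simp only [hl, hB, Finset.pair_eq_singleton, Finset.sum_singleton, if_true]
          linear_combination (2 * A e * G.conductance k e * q.1 (G.tgt e)) * hcs e -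
            (2 * A e * Real.sin (G.phase k e) * q.1 (G.tgt e)) * hg e
        · rw [Finset.sum_pair hl]
          simp only [if_true, hl, Ne.symm hl, if_false]
          linear_combination
            (A e * G.conductance k e * (q.1 (G.src e) + q.1 (G.tgt e))) * hcs e -
            (q.1 (G.src e) * (A e * Real.sin (G.phase k e) + B e * Real.cos (G.phase k e)) +
              q.1 (G.tgt e) * (A e * Real.sin (G.phase k e) - B e * Real.cos (G.phase k e))) * hg e
      rw [key, neg_eq_zero]
      -- `V` is not assumed finite, so the sums are exchanged over the finite set of endpoints.
      let S : Finset V := Finset.univ.biUnion fun e => {G.src e, G.tgt e}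
      have hS : ∀ e, ({G.src e, G.tgt e} : Finset V) ⊆ S := fun e =>
        Finset.subset_biUnion_of_mem (fun e => ({G.src e, G.tgt e} : Finset V)) (Finset.mem_univ e)
      rw [Finset.sum_congr rfl fun e _ => Finset.sum_subset (hS e) fun v _ hv => by
        simp only [Finset.mem_insert, Finset.mem_singleton, not_or] at hv
        rw [if_neg (Ne.symm hv.1), if_neg (Ne.symm hv.2), add_zero, mul_zero], Finset.sum_comm]
      refine Finset.sum_eq_zero fun v _ => ?_
      rw [← Finset.mul_sum, hK v, mul_zero]
  · rintro ⟨p, hp0, hp⟩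
    obtain ⟨hm, hv⟩ := kirchhoff_of_form_eq_zero hk.le h hp
    -- The even coefficient is the midpoint value; the odd one is read off from the difference of
    -- the end values.
    refine ⟨p.2, fun e => (p.1 (G.tgt e) - p.1 (G.src e)) / (2 * Real.sin (G.phase k e)), ?_,
      ⟨p.1, fun e => ?_⟩, fun v => ?_⟩
    · by_contra! hz
      refine hp0 (Prod.ext (funext fun v => ?_) (funext fun e => (hz e).1))
      obtain ⟨e, he⟩ := hV v
      have h1 := hm e
      have h2 := (div_eq_zero_iff.1 (hz e).2).resolve_right (mul_pos two_pos (hs e)).ne'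
      rw [(hz e).1] at h1
      rcases he with rfl | rfl <;> simp only [Prod.fst_zero, Pi.zero_apply] <;> linarith
    · have := hm e
      have := (hs e).ne'
      constructor
      · field_simp
        linarith
      · field_simp
        linarith
    · refine (mul_eq_zero.1 ((Finset.mul_sum _ _ _).trans (Eq.trans ?_ (hv v)))).resolve_left hk.ne'
      refine Finset.sum_congr rfl fun e _ => ?_
      have h1 := hm e
      have h2 := (hs e).ne'
      have h3 := hcs e
      have h4 : ∀ x, k * x = G.conductance k e * (Real.sin (G.phase k e) * x) := fun x => by
        rw [← mul_assoc, hg]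
      rw [h4, mul_add (Real.sin _), mul_ite, mul_ite, mul_zero]
      congr 3
      · field_simp
        linear_combination (2 * p.2 e) * h3 + Real.cos (G.phase k e) * h1
      · field_simp
        linear_combination (2 * p.2 e) * h3 + Real.cos (G.phase k e) * h1

end Forms

end MetricGraph

namespace MetricGraph

variable {V E : Type*}

/-! ### Consequences of connectedness. -/

section Connected

variable {G : MetricGraph V E}

theorem Connected.exists_edge_at [Nonempty E] (hG : G.Connected) (v : V) :
    ∃ e, G.src e = v ∨ G.tgt e = v := by
  by_contra! hv
  obtain ⟨e₀⟩ := ‹Nonempty E›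
  have : Nontrivial V := ⟨_, _, (hv e₀).1⟩
  obtain ⟨w, hw⟩ := hG.preconnected.exists_adj_of_nontrivial v
  rw [SimpleGraph.fromRel_adj] at hw
  rcases hw.2 with ⟨e, he, -⟩ | ⟨e, -, he⟩
  · exact (hv e).1 he
  · exact (hv e).2 he

theorem Connected.finite [Finite E] [Nonempty E] (hG : G.Connected) : Finite V := by
  have : Function.Surjective (Sum.elim G.src G.tgt) := fun v => by
    obtain ⟨e, he | he⟩ := hG.exists_edge_at v
    · exact ⟨Sum.inl e, he⟩
    · exact ⟨Sum.inr e, he⟩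
  exact Finite.of_surjective _ this

theorem Connected.eq_of_forall_edge {α : Type*} (hG : G.Connected) {φ : V → α}
    (h : ∀ e, φ (G.src e) = φ (G.tgt e)) (v w : V) : φ v = φ w := by
  obtain ⟨p⟩ := hG.preconnected v w
  induction p with
  | nil => rfl
  | cons hadj _ ih =>
    rw [← ih]
    rw [SimpleGraph.fromRel_adj] at hadj
    rcases hadj.2 with ⟨e, rfl, rfl⟩ | ⟨e, rfl, rfl⟩
    · exact h e
    · exact (h e).symm

/-- The vertices `v` and `w` may coincide, which is the flower case. -/
theorem Connected.isPumpkin_or_isFlower [Nonempty E] (hG : G.Connected) {v w : V}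
    (h : ∀ e, (G.src e = v ∧ G.tgt e = w) ∨ (G.src e = w ∧ G.tgt e = v)) :
    G.IsPumpkin ∨ G.IsFlower := by
  have hV : ∀ x, x = v ∨ x = w := fun x => by
    obtain ⟨e, he⟩ := hG.exists_edge_at x
    rcases h e with ⟨h1, h2⟩ | ⟨h1, h2⟩ <;> rcases he with rfl | rfl <;> simp [h1, h2]
  by_cases hvw : v = w
  · subst hvw
    exact Or.inr ⟨v, fun x => (hV x).elim id id, fun e => (h e).elim id id⟩
  · exact Or.inl ⟨v, w, hvw, hV, h⟩

end Connected

/-! ### The least frequency at which positivity fails. -/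

section Compactness

variable [Fintype E] {G : MetricGraph V E} {K : ℝ}

/-- At `k = 0` the form is the weighted Dirichlet energy of the subdivided graph, which vanishes
only on constants. -/
theorem redForm_zero_pos (hG : G.Connected) [Nonempty E] (v₀ : V) {p : (V → ℝ) × (E → ℝ)}
    (hv₀ : p.1 v₀ = 0) (hp : p ≠ 0) : 0 < G.redForm 0 p p := by
  have hadm : ∀ e, 0 * G.len e < 2 * Real.pi := fun e => by
    rw [zero_mul]; exact Real.two_pi_pos
  have hW := mean_one_pos le_rfl hadm
  have hform : G.form 0 p p = ∑ e, G.conductance 0 e *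
      ((p.1 (G.src e) - p.2 e) ^ 2 + (p.1 (G.tgt e) - p.2 e) ^ 2) := by
    refine Finset.sum_congr rfl fun e _ => ?_
    simp only [phase, zero_mul, Real.cos_zero]
    ring
  have hnn : ∀ e ∈ Finset.univ, 0 ≤ G.conductance 0 e *
      ((p.1 (G.src e) - p.2 e) ^ 2 + (p.1 (G.tgt e) - p.2 e) ^ 2) := fun e _ =>
    mul_nonneg (conductance_pos le_rfl (hadm e)).le (by positivity)
  have hpos : 0 < G.form 0 p p := by
    refine lt_of_le_of_ne (hform ▸ Finset.sum_nonneg hnn) fun h0 => hp ?_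
    rw [hform, eq_comm, Finset.sum_eq_zero_iff_of_nonneg hnn] at h0
    have hz : ∀ e, p.1 (G.src e) = p.2 e ∧ p.1 (G.tgt e) = p.2 e := fun e => by
      have := (mul_eq_zero.1 (h0 e (Finset.mem_univ e))).resolve_left
        (conductance_pos le_rfl (hadm e)).ne'
      constructor <;> nlinarith [sq_nonneg (p.1 (G.src e) - p.2 e),
        sq_nonneg (p.1 (G.tgt e) - p.2 e)]
    have h1 : ∀ v, p.1 v = 0 := fun v =>
      (hG.eq_of_forall_edge (fun e => (hz e).1.trans (hz e).2.symm) v v₀).trans hv₀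
    exact Prod.ext (funext h1) (funext fun e => (hz e).1.symm.trans (h1 _))
  rw [redForm]
  nlinarith [mul_pos hW hpos]

/-- `redForm` is shift-invariant and quadratic, so its sign need only be studied on a compact slice
of the unit sphere that is independent of `k`. -/
theorem exists_unit_representative [Fintype V] (G : MetricGraph V E) (v₀ : V)
    {q : (V → ℝ) × (E → ℝ)} (hq : ∀ c : ℝ, q ≠ c • 1) :
    ∃ p : (V → ℝ) × (E → ℝ), p.1 v₀ = 0 ∧ ‖p‖ = 1 ∧
      ∃ t : ℝ, 0 < t ∧ ∀ k, G.redForm k q q = t * G.redForm k p p := by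
  set r := q + (-q.1 v₀) • 1 with hr
  have hr0 : r ≠ 0 := fun h => hq (q.1 v₀) (by
    rw [hr, neg_smul, ← sub_eq_add_neg, sub_eq_zero] at h
    exact h)
  have hn := norm_pos_iff.2 hr0
  refine ⟨‖r‖⁻¹ • r, ?_, ?_, ‖r‖ ^ 2, by positivity, fun k => ?_⟩
  · simp [hr]
  · rw [norm_smul, norm_inv, norm_norm, inv_mul_cancel₀ hn.ne']
  · rw [redForm_smul_self, hr, redForm_add_const, ← hr]
    field_simp

theorem continuousOn_redForm [Fintype V] (hadm : ∀ e, K * G.len e < 2 * Real.pi) :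
    ContinuousOn (fun z : ℝ × ((V → ℝ) × (E → ℝ)) => G.redForm z.1 z.2 z.2)
      (Icc 0 K ×ˢ univ) := by
  have hphase : ∀ e, Continuous fun z : ℝ × ((V → ℝ) × (E → ℝ)) => G.phase z.1 e := fun e => by
    simp only [phase]; fun_prop
  have hg : ∀ e, ContinuousOn (fun z : ℝ × ((V → ℝ) × (E → ℝ)) => G.conductance z.1 e)
      (Icc 0 K ×ˢ univ) := fun e => by
    refine ContinuousOn.inv₀ (continuous_const.mul
      (Real.continuous_sinc.comp (hphase e))).continuousOn fun z hz => ?_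
    refine (mul_pos (half_pos (G.len_pos e)) (sinc_phase_pos hz.1.1 (lt_of_le_of_lt ?_ (hadm e)))).ne'
    exact mul_le_mul_of_nonneg_right hz.1.2 (G.len_pos e).le
  have hw : ∀ e, ContinuousOn (fun z : ℝ × ((V → ℝ) × (E → ℝ)) => G.mass z.1 e)
      (Icc 0 K ×ˢ univ) := fun e =>
    (hg e).mul (continuous_const.mul
      ((Real.continuous_sinc.comp ((hphase e).div_const 2)).pow 2)).continuousOn
  have hmean : ContinuousOn (fun z : ℝ × ((V → ℝ) × (E → ℝ)) => G.mean z.1 z.2)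
      (Icc 0 K ×ˢ univ) :=
    continuousOn_finsetSum _ fun e _ => (hw e).mul (by fun_prop)
  have hone : ContinuousOn (fun z : ℝ × ((V → ℝ) × (E → ℝ)) => G.mean z.1 1)
      (Icc 0 K ×ˢ univ) :=
    continuousOn_finsetSum _ fun e _ => (hw e).mul continuousOn_const
  have hform : ContinuousOn (fun z : ℝ × ((V → ℝ) × (E → ℝ)) => G.form z.1 z.2 z.2)
      (Icc 0 K ×ˢ univ) :=
    continuousOn_finsetSum _ fun e _ => (hg e).mul (by
      have := Real.continuous_cos.comp (hphase e)
      simp only [Function.comp_def] at this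
      fun_prop)
  exact (hone.mul hform).add ((continuous_fst.pow 2).continuousOn.mul (hmean.mul hmean))

/-- If the reduced form at `K` is nonpositive on some nonconstant vector, then `-Δ` has a least
positive eigenvalue, it is at most `K²`, and the reduced form there is positive semidefinite. -/
theorem exists_isLeast_posEigenvalues [Nonempty E] (hG : G.Connected) (hK : 0 < K)
    (hadm : ∀ e, K * G.len e < 2 * Real.pi)
    (hex : ∃ p : (V → ℝ) × (E → ℝ), (∀ c : ℝ, p ≠ c • 1) ∧ G.redForm K p p ≤ 0) :
    ∃ k, 0 < k ∧ k ≤ K ∧ IsLeast G.posEigenvalues (k ^ 2) ∧ ∀ q, 0 ≤ G.redForm k q q := by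
  have := hG.finite
  have := Fintype.ofFinite V
  have hadm' : ∀ k, k ≤ K → ∀ e, k * G.len e < 2 * Real.pi := fun k hk e =>
    (mul_le_mul_of_nonneg_right hk (G.len_pos e).le).trans_lt (hadm e)
  obtain ⟨e₀⟩ := ‹Nonempty E›
  have : Nonempty E := ⟨e₀⟩
  set v₀ := G.src e₀
  set S : Set ((V → ℝ) × (E → ℝ)) := {p | p.1 v₀ = 0} ∩ Metric.sphere 0 1 with hS
  have hScomp : IsCompact S :=
    (isCompact_sphere _ _).inter_left (isClosed_eq (by fun_prop) continuous_const)
  have hS0 : ∀ p ∈ S, p ≠ 0 := fun p hp h0 => by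
    have := hp.2
    simp [h0] at this
  -- The set of failures of positivity is compact, so its projection to frequencies has a least
  -- element.
  set Z : Set (ℝ × ((V → ℝ) × (E → ℝ))) := (Icc 0 K ×ˢ S) ∩
    {z | G.redForm z.1 z.2 z.2 ∈ Iic (0 : ℝ)} with hZ
  have hcont := continuousOn_redForm hadm
  have hZcomp : IsCompact Z := by
    refine (isCompact_Icc.prod hScomp).of_isClosed_subset ?_ inter_subset_left
    exact (hcont.mono (prod_mono_right (subset_univ _))).preimage_isClosed_of_isClosed
      (isClosed_Icc.prod hScomp.isClosed) isClosed_Iic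
  have hrep : ∀ k ∈ Icc 0 K, ∀ q : (V → ℝ) × (E → ℝ), (∀ c : ℝ, q ≠ c • 1) →
      G.redForm k q q ≤ 0 → k ∈ Prod.fst '' Z := by
    intro k hk q hq hneg
    obtain ⟨p, hp0, hp1, t, ht, hqp⟩ := G.exists_unit_representative v₀ hq
    refine ⟨(k, p), ⟨⟨hk, hp0, by simpa using hp1⟩, ?_⟩, rfl⟩
    rw [hqp] at hneg
    exact nonpos_of_mul_nonpos_right hneg ht
  obtain ⟨pK, hpK, hpK0⟩ := hex
  obtain ⟨k, ⟨⟨k', p⟩, ⟨⟨hkK, hpS⟩, hneg⟩, hk'⟩, hleast⟩ :=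
    (hZcomp.image continuous_fst).exists_isLeast ⟨K, hrep K ⟨hK.le, le_rfl⟩ pK hpK hpK0⟩
  obtain rfl : k' = k := hk'
  rw [mem_ofPred_eq, mem_Iic] at hneg
  have hk0 : 0 < k' := by
    refine hkK.1.lt_of_ne fun h0 => ?_
    subst h0
    exact hneg.not_gt (redForm_zero_pos hG v₀ hpS.1 (hS0 p hpS))
  -- Below `k'` the form is positive on nonconstant vectors; let the frequency tend to `k'` from the
  -- left.
  have hnnS : ∀ q, (∀ c : ℝ, q ≠ c • 1) → 0 ≤ G.redForm k' q q := by
    intro q hq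
    have hc : ContinuousWithinAt (fun κ => G.redForm κ q q) (Ico 0 k') k' := by
      have h1 : ContinuousOn (fun κ => G.redForm κ q q) (Icc 0 K) :=
        hcont.comp (f := fun κ : ℝ => (κ, q)) (by fun_prop) fun κ hκ => ⟨hκ, mem_univ _⟩
      exact (h1 k' hkK).mono fun κ hκ => ⟨hκ.1, hκ.2.le.trans hkK.2⟩
    have := right_nhdsWithin_Ico_neBot hk0
    refine ge_of_tendsto hc (Filter.eventually_of_mem self_mem_nhdsWithin fun κ hκ => ?_)
    by_contra! hlt
    exact hκ.2.not_ge (hleast (hrep κ ⟨hκ.1, hκ.2.le.trans hkK.2⟩ q hq hlt.le))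
  have hnn : ∀ q, 0 ≤ G.redForm k' q q := by
    intro q
    by_cases hq : ∃ c : ℝ, q = c • 1
    · obtain ⟨c, rfl⟩ := hq
      rw [redForm_smul_self, redForm_one_left, mul_zero]
    · exact hnnS q (not_exists.1 hq)
  refine ⟨k', hk0, hkK.2, ⟨⟨by positivity, ?_⟩, ?_⟩, hnn⟩
  · rw [isEigenvalue_sq_iff_form hk0 (hadm' k' hkK.2) hG.exists_edge_at]
    obtain ⟨c, hc⟩ := form_eq_zero_of_redForm hk0.le (hadm' k' hkK.2)
      (redForm_eq_zero_of_nonneg hnn hneg)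
    refine ⟨_, fun h0 => hS0 p hpS ?_, hc⟩
    have h1 : c = 0 := by
      have h2 := congrFun (congrArg Prod.fst h0) v₀
      have h3 : p.1 v₀ = 0 := hpS.1
      simpa [h3] using h2
    simpa [h1] using h0
  · rintro μ ⟨hμ, heig⟩
    rw [← Real.sq_sqrt hμ.le] at heig ⊢
    have hκ := Real.sqrt_pos.2 hμ
    generalize √μ = κ at heig hκ
    refine pow_le_pow_left₀ hk0.le ?_ 2
    -- An eigenvalue `κ²` with `κ < k'` would give a kernel vector of mean zero, on which `redForm
    -- κ` vanishes, against the minimality of `k'`.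
    by_contra! hlt
    have hκK := hlt.le.trans hkK.2
    rw [isEigenvalue_sq_iff_form hκ (hadm' κ hκK) hG.exists_edge_at] at heig
    obtain ⟨q, hq0, hq⟩ := heig
    have hmean : G.mean κ q = 0 := by
      have := form_one_left G κ q
      rw [form_comm, hq, eq_comm, neg_eq_zero] at this
      exact (mul_eq_zero.1 this).resolve_left (by positivity)
    refine hlt.not_ge (hleast (hrep κ ⟨hκ.le, hκK⟩ q ?_ ?_))
    · rintro c rfl
      have h1 := mean_add_smul G κ 0 1 c
      have h2 : G.mean κ 0 = 0 := by simp [mean]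
      rw [zero_add, hmean, h2, zero_add, eq_comm, mul_eq_zero] at h1
      exact hq0 (by rw [h1.resolve_right (mean_one_pos hκ.le (hadm' κ hκK)).ne', zero_smul])
    · rw [redForm, hq, hmean]
      simp

end Compactness

end MetricGraph

namespace MetricGraph

variable {V E : Type*}

/-! ### The test vector on two edges, and the case of equality. -/

section TestVector

variable {G : MetricGraph V E} {K : ℝ} {e₁ e₂ : E}

open Classical in
/-- The values at the vertices and at the midpoints of the edges of the function that equals
`cos (K (x - len e₁ / 2))` on `e₁`, minus the like on `e₂`, and a constant on the other edges. -/
noncomputable def testVec (G : MetricGraph V E) (K : ℝ) (e₁ e₂ : E) : (V → ℝ) × (E → ℝ) :=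
  (fun _ => Real.cos (G.phase K e₁), fun e =>
    if e = e₁ then 1 else if e = e₂ then -1 else Real.cos (G.phase K e₁))

theorem testVec_fst (v : V) : (testVec G K e₁ e₂).1 v = Real.cos (G.phase K e₁) := rfl

theorem testVec_snd_left : (testVec G K e₁ e₂).2 e₁ = 1 := if_pos rfl

theorem testVec_snd_right (hne : e₁ ≠ e₂) : (testVec G K e₁ e₂).2 e₂ = -1 := by
  simp [testVec, hne.symm]

theorem testVec_snd_of_ne {e : E} (h₁ : e ≠ e₁) (h₂ : e ≠ e₂) :
    (testVec G K e₁ e₂).2 e = Real.cos (G.phase K e₁) := by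
  simp [testVec, h₁, h₂]

theorem testVec_ne_const (hne : e₁ ≠ e₂) (c : ℝ) : testVec G K e₁ e₂ ≠ c • 1 := by
  intro h
  have h1 : (testVec G K e₁ e₂).2 e₁ = c := by simp [h]
  have h2 : (testVec G K e₁ e₂).2 e₂ = c := by simp [h]
  rw [testVec_snd_left] at h1
  rw [testVec_snd_right hne] at h2
  linarith

theorem conductance_eq_of_phase_add (hK : 0 < K) (hadm : ∀ e, K * G.len e < 2 * Real.pi)
    (hsum : G.phase K e₁ + G.phase K e₂ = Real.pi) :
    Real.cos (G.phase K e₂) = -Real.cos (G.phase K e₁) ∧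
      G.conductance K e₂ = G.conductance K e₁ := by
  have h2 : G.phase K e₂ = Real.pi - G.phase K e₁ := by linarith
  refine ⟨by rw [h2, Real.cos_pi_sub], ?_⟩
  have h3 := conductance_mul_sin hK.le (hadm e₂)
  rw [h2, Real.sin_pi_sub] at h3
  exact mul_right_cancel₀ (sin_phase_pos hK (hadm e₁)).ne'
    (h3.trans (conductance_mul_sin hK.le (hadm e₁)).symm)

theorem endpoints_eq_of_ends_eq (h : ∀ v, open Classical in
    ((if G.src e₁ = v then 1 else 0) + (if G.tgt e₁ = v then 1 else 0) : ℝ) =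
      (if G.src e₂ = v then 1 else 0) + (if G.tgt e₂ = v then 1 else 0)) :
    (G.src e₂ = G.src e₁ ∧ G.tgt e₂ = G.tgt e₁) ∨ (G.src e₂ = G.tgt e₁ ∧ G.tgt e₂ = G.src e₁) := by
  have h1 := h (G.src e₁)
  have h2 := h (G.tgt e₁)
  split_ifs at h1 h2 <;> grind

variable [Fintype E]

open Classical in
theorem sum_eq_add_add_sum_erase (hne : e₁ ≠ e₂) (f : E → ℝ) :
    ∑ e, f e = f e₁ + f e₂ + ∑ e ∈ (Finset.univ.erase e₁).erase e₂, f e := by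
  rw [← Finset.add_sum_erase _ f (Finset.mem_univ e₁),
    ← Finset.add_sum_erase _ f (Finset.mem_erase.2 ⟨hne.symm, Finset.mem_univ e₂⟩), add_assoc]

/-- The contributions of `e₁` and `e₂` cancel, both in the form and in the mean. The other edges, of
total mass `W`, leave `-4c²K²W` and `4cW` with `c = cos (phase e₁)`, and the squared mean is too
small to make up for the negative form. -/
theorem redForm_testVec_nonpos (hK : 0 < K) (hadm : ∀ e, K * G.len e < 2 * Real.pi)
    (hne : e₁ ≠ e₂) (hsum : G.phase K e₁ + G.phase K e₂ = Real.pi) :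
    G.redForm K (testVec G K e₁ e₂) (testVec G K e₁ e₂) ≤ 0 := by
  classical
  obtain ⟨hcos, hg⟩ := conductance_eq_of_phase_add hK hadm hsum
  have hmass := sq_mul_mass G K
  set s := (Finset.univ.erase e₁).erase e₂ with hs
  set W := ∑ e ∈ s, G.mass K e with hW
  have hs1 : ∀ e ∈ s, e ≠ e₁ ∧ e ≠ e₂ := fun e he => by
    simp only [hs, Finset.mem_erase] at he
    exact ⟨he.2.1, he.1⟩
  set c := Real.cos (G.phase K e₁) with hc
  have hm1 := hmass e₁
  have hm2 := hmass e₂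
  rw [hg, hcos] at hm2
  have hone : G.mean K (1 : (V → ℝ) × (E → ℝ)) = 4 * (G.mass K e₁ + G.mass K e₂ + W) := by
    rw [← sum_eq_add_add_sum_erase hne, mean, Finset.mul_sum]
    refine Finset.sum_congr rfl fun e _ => ?_
    simp only [Prod.fst_one, Prod.snd_one, Pi.one_apply]
    ring
  have hmean : G.mean K (testVec G K e₁ e₂) = 4 * c * W := by
    rw [mean, sum_eq_add_add_sum_erase hne, testVec_snd_left, testVec_snd_right hne,
      Finset.sum_congr rfl fun e he => by rw [testVec_snd_of_ne (hs1 e he).1 (hs1 e he).2]]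
    simp only [testVec_fst, ← hc]
    rw [← Finset.sum_mul]
    have hK2 : K ^ 2 ≠ 0 := by positivity
    apply mul_left_cancel₀ hK2
    linear_combination (2 * c + 2) * hm1 + (2 * c - 2) * hm2
  have hform : G.form K (testVec G K e₁ e₂) (testVec G K e₁ e₂) = -(4 * c ^ 2 * K ^ 2 * W) := by
    rw [form, sum_eq_add_add_sum_erase hne, testVec_snd_left, testVec_snd_right hne,
      Finset.sum_congr rfl fun e he => by rw [testVec_snd_of_ne (hs1 e he).1 (hs1 e he).2]]
    simp only [testVec_fst, ← hc, hcos, hg]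
    rw [hW, Finset.mul_sum, ← Finset.sum_neg_distrib,
      Finset.sum_congr rfl (g := fun e => -(4 * c ^ 2 * K ^ 2 * G.mass K e)) fun e _ => by
        linear_combination (4 * c ^ 2) * hmass e]
    ring
  have hW0 : 0 ≤ W := Finset.sum_nonneg fun e _ => (mass_pos hK.le (hadm e)).le
  have h1 := mass_pos hK.le (hadm e₁)
  have h2 := mass_pos hK.le (hadm e₂)
  have : G.redForm K (testVec G K e₁ e₂) (testVec G K e₁ e₂) =
      -(16 * c ^ 2 * K ^ 2 * W * (G.mass K e₁ + G.mass K e₂)) := by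
    rw [redForm, hone, hmean, hform]
    ring
  rw [this, neg_nonpos]
  positivity

open Classical in
/-- In the case of equality, `e₁` and `e₂` have the same number of ends at each vertex. -/
theorem ends_eq_of_redForm_nonneg (hK : 0 < K) (hadm : ∀ e, K * G.len e < 2 * Real.pi)
    (hne : e₁ ≠ e₂) (hsum : G.phase K e₁ + G.phase K e₂ = Real.pi)
    (hnn : ∀ q, 0 ≤ G.redForm K q q)
    (hrest : Real.cos (G.phase K e₁) = 0 ∨ ∀ e, e = e₁ ∨ e = e₂) (v : V) :
    ((if G.src e₁ = v then 1 else 0) + (if G.tgt e₁ = v then 1 else 0) : ℝ) =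
      (if G.src e₂ = v then 1 else 0) + (if G.tgt e₂ = v then 1 else 0) := by
  have : Nonempty E := ⟨e₁⟩
  obtain ⟨hcos, hg⟩ := conductance_eq_of_phase_add hK hadm hsum
  obtain ⟨d, hd⟩ := form_eq_zero_of_redForm hK.le hadm
    (redForm_eq_zero_of_nonneg hnn (redForm_testVec_nonpos hK hadm hne hsum))
  have hc1 : Real.cos (G.phase K e₁) < 1 := by
    have h1 := sq_mul_mass G K e₁
    have h2 := mass_pos hK.le (hadm e₁)
    have h3 : 0 < G.conductance K e₁ * (1 - Real.cos (G.phase K e₁)) := h1 ▸ by positivity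
    linarith [pos_of_mul_pos_right h3 (conductance_pos hK.le (hadm e₁)).le]
  -- The Kirchhoff condition at the midpoint of `e₁` already holds for the test vector, so it rules
  -- out a shift.
  have hd0 : d = 0 := by
    have h1 := (kirchhoff_of_form_eq_zero hK.le hadm hd).1 e₁
    simp only [Prod.fst_add, Prod.snd_add, Prod.smul_fst, Prod.smul_snd, Pi.add_apply,
      Pi.smul_apply, Prod.fst_one, Prod.snd_one, Pi.one_apply, testVec_fst, testVec_snd_left,
      smul_eq_mul, mul_one] at h1
    have h2 : d * (1 - Real.cos (G.phase K e₁)) = 0 := by linarith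
    exact (mul_eq_zero.1 h2).resolve_right (by linarith)
  rw [hd0, zero_smul, add_zero] at hd
  have hv := (kirchhoff_of_form_eq_zero hK.le hadm hd).2 v
  rw [sum_eq_add_add_sum_erase hne, Finset.sum_eq_zero (s := (Finset.univ.erase e₁).erase e₂)]
    at hv
  · simp only [testVec_fst, testVec_snd_left, testVec_snd_right hne, hg, hcos] at hv
    -- Each end of `e₁` contributes this amount to the Kirchhoff sum, each end of `e₂` its negative,
    -- and the other edges nothing.
    have hpos := mul_pos (conductance_pos hK.le (hadm e₁)) (pow_pos (sin_phase_pos hK (hadm e₁)) 2)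
    rw [Real.sin_sq] at hpos
    apply mul_left_cancel₀ hpos.ne'
    split_ifs at hv ⊢ <;> linarith
  · intro e he
    simp only [Finset.mem_erase] at he
    rcases hrest with h0 | h0
    · simp [testVec_fst, testVec_snd_of_ne he.2.1 he.1, h0]
    · exact absurd (h0 e) (by simp [he.1, he.2.1])

/-- For a longest edge `e₁` and another edge `e₂`, the spectral gap is at most
`(2π / (len e₁ + len e₂))²`; equality makes the two edges parallel, if moreover the two edges have
equal length or there are no further edges. -/
theorem spectralGap_le_of_longest (hG : G.Connected) (hne : e₁ ≠ e₂)
    (hmax : ∀ e, G.len e ≤ G.len e₁) :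
    IsLeast G.posEigenvalues G.spectralGap ∧
    G.spectralGap ≤ (2 * Real.pi / (G.len e₁ + G.len e₂)) ^ 2 ∧
    (G.spectralGap = (2 * Real.pi / (G.len e₁ + G.len e₂)) ^ 2 →
      (G.len e₁ = G.len e₂ ∨ ∀ e, e = e₁ ∨ e = e₂) →
      (G.src e₂ = G.src e₁ ∧ G.tgt e₂ = G.tgt e₁) ∨
        (G.src e₂ = G.tgt e₁ ∧ G.tgt e₂ = G.src e₁)) := by
  have : Nonempty E := ⟨e₁⟩
  have hl1 := G.len_pos e₁
  have hl2 := G.len_pos e₂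
  set K := 2 * Real.pi / (G.len e₁ + G.len e₂) with hKdef
  have hKmul : K * (G.len e₁ + G.len e₂) = 2 * Real.pi := div_mul_cancel₀ _ (by positivity)
  have hK : 0 < K := by have := Real.pi_pos; positivity
  have hadm : ∀ e, K * G.len e < 2 * Real.pi := fun e => by
    rw [← hKmul]
    exact mul_lt_mul_of_pos_left (by linarith [hmax e]) hK
  have hsum : G.phase K e₁ + G.phase K e₂ = Real.pi := by
    simp only [phase]
    linarith
  obtain ⟨k, hk, hkK, hleast, hnn⟩ := exists_isLeast_posEigenvalues hG hK hadm
    ⟨_, testVec_ne_const hne, redForm_testVec_nonpos hK hadm hne hsum⟩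
  have hgap : G.spectralGap = k ^ 2 := hleast.csInf_eq
  refine ⟨hgap ▸ hleast, hgap ▸ pow_le_pow_left₀ hk.le hkK 2, fun heq hrest => ?_⟩
  rw [hgap, sq_eq_sq₀ hk.le hK.le] at heq
  refine endpoints_eq_of_ends_eq
    (ends_eq_of_redForm_nonneg hK hadm hne hsum (heq ▸ hnn) (hrest.imp_left fun h => ?_))
  have : G.phase K e₁ = Real.pi / 2 := by
    rw [phase]
    rw [← h] at hKmul
    linarith
  rw [this, Real.cos_pi_div_two]

end TestVector

end MetricGraph

/-! ### Flowers and pumpkins have no small positive eigenvalues. -/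

namespace MetricGraph

variable {V E : Type*} [Fintype E] {G : MetricGraph V E} {k : ℝ}

/-- The even and odd parts of an eigenfunction on a flower or a pumpkin solve linear systems of
this shape. -/
def IsNondegenerate (a b : E → ℝ) : Prop :=
  ∀ x : E → ℝ, ∀ p : ℝ, (∀ e, x e * a e = p) → ∑ e, x e * b e = 0 → ∀ e, x e = 0

theorem isNondegenerate_const {a b : E → ℝ} (α β : ℝ) (ha : ∀ e, a e = α) (hb : ∀ e, b e = β)
    (hα : α ≠ 0) (hβ : β ≠ 0) : IsNondegenerate a b := by
  intro x p hx hsum e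
  have hxe : ∀ e, x e = p / α := fun e => by rw [eq_div_iff hα, ← ha e, hx]
  have : Nonempty E := ⟨e⟩
  simp only [hxe, hb, Finset.sum_const, nsmul_eq_mul, Finset.card_univ] at hsum
  rw [hxe]
  have hc : (Fintype.card E : ℝ) ≠ 0 := by exact_mod_cast Fintype.card_ne_zero
  exact (mul_eq_zero.1 ((mul_eq_zero.1 hsum).resolve_left hc)).resolve_right hβ

theorem isNondegenerate_pair {a b : E → ℝ} {e₁ e₂ : E} (hne : e₁ ≠ e₂)
    (huniv : ∀ e, e = e₁ ∨ e = e₂) (hdet : b e₁ * a e₂ + b e₂ * a e₁ ≠ 0) :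
    IsNondegenerate a b := by
  classical
  intro x p hx hsum
  have hu : (Finset.univ : Finset E) = {e₁, e₂} := by
    ext e
    simpa using huniv e
  rw [hu, Finset.sum_pair hne] at hsum
  have h1 := hx e₁
  have h2 := hx e₂
  have h3 : x e₁ * (b e₁ * a e₂ + b e₂ * a e₁) = 0 := by
    linear_combination a e₂ * hsum + b e₂ * h1 - b e₂ * h2
  have h4 : x e₂ * (b e₁ * a e₂ + b e₂ * a e₁) = 0 := by
    linear_combination a e₁ * hsum - b e₁ * h1 + b e₁ * h2
  intro e
  rcases huniv e with rfl | rfl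
  · exact (mul_eq_zero.1 h3).resolve_right hdet
  · exact (mul_eq_zero.1 h4).resolve_right hdet

/-- Both ends of a loop carry the same value, so the odd part vanishes wherever `sin (phase) ≠ 0`;
only the even system remains. -/
theorem IsFlower.not_isEigenvalue (hG : G.IsFlower) (hk : 0 < k)
    (hadm : ∀ e, k * G.len e < 2 * Real.pi)
    (heven : IsNondegenerate (fun e => Real.cos (G.phase k e)) fun e => Real.sin (G.phase k e)) :
    ¬G.IsEigenvalue (k ^ 2) := by
  rw [isEigenvalue_sq_iff G hk]
  rintro ⟨A, B, ⟨e₀, he₀⟩, ⟨φ, hφ⟩, hK⟩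
  obtain ⟨v, -, hv⟩ := hG
  simp only [(hv _).1, (hv _).2] at hφ
  have hK := hK v
  rw [Finset.sum_congr rfl fun e _ => by rw [if_pos (hv e).1, if_pos (hv e).2]] at hK
  have hA := heven A (φ v) (fun e => by linarith [(hφ e).1, (hφ e).2]) (by
    rw [← mul_right_inj' two_ne_zero, mul_zero, Finset.mul_sum]
    exact (Finset.sum_congr rfl fun e _ => by ring).trans hK)
  refine he₀.elim (fun h => h (hA e₀)) fun hB => ?_
  exact mul_ne_zero hB (sin_phase_pos hk (hadm e₀)).ne' (by linarith [(hφ e₀).1, (hφ e₀).2])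

theorem IsPumpkin.not_isEigenvalue (hG : G.IsPumpkin) (hk : 0 < k)
    (heven : IsNondegenerate (fun e => Real.cos (G.phase k e)) fun e => Real.sin (G.phase k e))
    (hodd : IsNondegenerate (fun e => Real.sin (G.phase k e)) fun e => Real.cos (G.phase k e)) :
    ¬G.IsEigenvalue (k ^ 2) := by
  classical
  rw [isEigenvalue_sq_iff G hk]
  rintro ⟨A, B, ⟨e₀, he₀⟩, ⟨φ, hφ⟩, hK⟩
  obtain ⟨v, w, hvw, -, hv⟩ := hG
  -- Orienting every edge from `v` to `w` changes the sign of the odd coefficient on reversed edges.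
  set C : E → ℝ := fun e => if G.src e = v then B e else -B e with hC
  have hφ' : ∀ e, A e * Real.cos (G.phase k e) - C e * Real.sin (G.phase k e) = φ v ∧
      A e * Real.cos (G.phase k e) + C e * Real.sin (G.phase k e) = φ w := fun e => by
    have h1 := hφ e
    rcases hv e with ⟨hs, ht⟩ | ⟨hs, ht⟩ <;> rw [hs, ht] at h1 <;>
      simp only [hC, hs, hvw.symm, if_true, if_false] <;> constructor <;> linarith [h1.1, h1.2]
  have hKv : ∑ e, (A e * Real.sin (G.phase k e) + C e * Real.cos (G.phase k e)) = 0 := by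
    refine Eq.trans (Finset.sum_congr rfl fun e _ => ?_) (hK v)
    rcases hv e with ⟨hs, ht⟩ | ⟨hs, ht⟩ <;> simp [hC, hs, ht, hvw.symm, sub_eq_add_neg]
  have hKw : ∑ e, (A e * Real.sin (G.phase k e) - C e * Real.cos (G.phase k e)) = 0 := by
    refine Eq.trans (Finset.sum_congr rfl fun e _ => ?_) (hK w)
    rcases hv e with ⟨hs, ht⟩ | ⟨hs, ht⟩ <;> simp [hC, hs, ht, hvw, hvw.symm]
  rw [Finset.sum_add_distrib] at hKv
  rw [Finset.sum_sub_distrib] at hKw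
  have hA := heven A ((φ v + φ w) / 2) (fun e => by linarith [(hφ' e).1, (hφ' e).2]) (by linarith)
  have hB := hodd C ((φ w - φ v) / 2) (fun e => by linarith [(hφ' e).1, (hφ' e).2]) (by linarith)
  refine he₀.elim (fun h => h (hA e₀)) fun h => h ?_
  have := hB e₀
  simp only [hC] at this
  split_ifs at this
  · exact this
  · exact neg_eq_zero.1 this

theorem isLeast_sq {K : ℝ} (hK : 0 < K) (heig : G.IsEigenvalue (K ^ 2))
    (hsmall : ∀ k, 0 < k → k < K → ¬G.IsEigenvalue (k ^ 2)) :
    IsLeast G.posEigenvalues (K ^ 2) := by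
  refine ⟨⟨by positivity, heig⟩, fun μ hμ => ?_⟩
  by_contra! hlt
  refine hsmall √μ (Real.sqrt_pos.2 hμ.1) ?_ ((Real.sq_sqrt hμ.1.le).symm ▸ hμ.2)
  rwa [Real.sqrt_lt hμ.1.le hK.le]

/-- A pumpkin or flower whose phases are equal and less than `π / 2`, or that has two edges, with
phases of sum less than `π`. -/
theorem not_isEigenvalue_of_isPumpkin_or_isFlower (hG : G.IsPumpkin ∨ G.IsFlower) (hk : 0 < k)
    (h : (∃ θ < Real.pi / 2, ∀ e, G.phase k e = θ) ∨ ∃ e₁ e₂, e₁ ≠ e₂ ∧ (∀ e, e = e₁ ∨ e = e₂) ∧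
      G.phase k e₁ + G.phase k e₂ < Real.pi) (hadm : ∀ e, k * G.len e < 2 * Real.pi) :
    ¬G.IsEigenvalue (k ^ 2) := by
  rcases isEmpty_or_nonempty E with hE | ⟨⟨e₀⟩⟩
  · rintro ⟨f, ⟨e, -⟩, -⟩
    exact hE.elim e
  obtain ⟨heven, hodd⟩ :
      IsNondegenerate (fun e => Real.cos (G.phase k e)) (fun e => Real.sin (G.phase k e)) ∧
      IsNondegenerate (fun e => Real.sin (G.phase k e)) (fun e => Real.cos (G.phase k e)) := by
    rcases h with ⟨θ, hθ, he⟩ | ⟨e₁, e₂, hne, hu, hlt⟩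
    · have hθ0 : 0 < θ := he e₀ ▸ phase_pos hk
      have hc := (Real.cos_pos_of_mem_Ioo ⟨by linarith, hθ⟩).ne'
      have hs := (Real.sin_pos_of_pos_of_lt_pi hθ0 (by linarith)).ne'
      exact ⟨isNondegenerate_const _ _ (fun e => by rw [he e]) (fun e => by rw [he e]) hc hs,
        isNondegenerate_const _ _ (fun e => by rw [he e]) (fun e => by rw [he e]) hs hc⟩
    -- The determinant of both two-edge systems is `sin (θ₁ + θ₂)`.
    · have hs : Real.sin (G.phase k e₁ + G.phase k e₂) ≠ 0 :=
        (Real.sin_pos_of_pos_of_lt_pi (add_pos (phase_pos hk) (phase_pos hk)) hlt).ne'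
      rw [Real.sin_add] at hs
      constructor <;> refine isNondegenerate_pair hne hu ?_ <;> convert hs using 1 <;> ring
  rcases hG with hG | hG
  · exact hG.not_isEigenvalue hk heven hodd
  · exact hG.not_isEigenvalue hk hadm heven

/-! ### Graphs with one edge. -/

section SingleEdge

variable {e₀ : E}

theorem isLeast_of_single_loop (hG : G.Connected) (hE : ∀ e, e = e₀)
    (h : G.src e₀ = G.tgt e₀) :
    IsLeast G.posEigenvalues ((2 * Real.pi / G.len e₀) ^ 2) := by
  have hl := G.len_pos e₀
  have hπ := Real.pi_pos
  have : Nonempty E := ⟨e₀⟩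
  have hK : 0 < 2 * Real.pi / G.len e₀ := by positivity
  have hF : G.IsFlower := ⟨G.src e₀, fun x => by
    obtain ⟨e, he⟩ := hG.exists_edge_at x
    rw [hE e, ← h, or_self] at he
    exact he.symm, fun e => by rw [hE e]; exact ⟨rfl, h.symm⟩⟩
  have huniq : (Finset.univ : Finset E) = {e₀} := by ext e; simpa using hE e
  refine isLeast_sq hK ?_ fun k hk hlt => ?_
  · rw [isEigenvalue_sq_iff G hK]
    have hphase : ∀ e, G.phase (2 * Real.pi / G.len e₀) e = Real.pi := fun e => by
      rw [phase, hE e]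
      field_simp
    exact ⟨1, 0, ⟨e₀, by simp⟩, ⟨fun _ => -1, by simp [hphase]⟩, by simp [hphase]⟩
  · have hadm : ∀ e, k * G.len e < 2 * Real.pi := fun e => by
      rw [hE e]
      rwa [lt_div_iff₀ hl] at hlt
    -- The cosine may vanish here, since the phase is only below `π`; the Kirchhoff equation alone
    -- suffices.
    refine hF.not_isEigenvalue hk hadm fun x p _ hs e => ?_
    rw [huniq, Finset.sum_singleton] at hs
    rw [hE e]
    exact (mul_eq_zero.1 hs).resolve_right (sin_phase_pos hk (hadm e₀)).ne'

theorem isLeast_of_single_path (hG : G.Connected) (hE : ∀ e, e = e₀)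
    (h : G.src e₀ ≠ G.tgt e₀) :
    IsLeast G.posEigenvalues ((Real.pi / G.len e₀) ^ 2) := by
  classical
  have hl := G.len_pos e₀
  have hπ := Real.pi_pos
  have : Nonempty E := ⟨e₀⟩
  have hK : 0 < Real.pi / G.len e₀ := by positivity
  have hP : G.IsPumpkin ∨ G.IsFlower :=
    hG.isPumpkin_or_isFlower fun e => Or.inl (by rw [hE e]; exact ⟨rfl, rfl⟩)
  refine isLeast_sq hK ?_ fun k hk hlt => ?_
  · rw [isEigenvalue_sq_iff G hK]
    have hphase : ∀ e, G.phase (Real.pi / G.len e₀) e = Real.pi / 2 := fun e => by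
      rw [phase, hE e]
      field_simp
    exact ⟨0, 1, ⟨e₀, by simp⟩, ⟨fun v => if v = G.src e₀ then -1 else 1, fun e => by
      simp [hphase, hE e, h.symm]⟩, by simp [hphase]⟩
  · rw [lt_div_iff₀ hl] at hlt
    refine not_isEigenvalue_of_isPumpkin_or_isFlower hP hk
      (Or.inl ⟨k * (G.len e₀ / 2), by linarith, fun e => by rw [phase, hE e]⟩) fun e => ?_
    rw [hE e]
    linarith

end SingleEdge

/-! ### The bound in terms of the total length, and equality. -/

theorem totalLength_pos [Nonempty E] (G : MetricGraph V E) : 0 < G.totalLength :=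
  Finset.sum_pos (fun e _ => G.len_pos e) Finset.univ_nonempty

/-- The two longest edges. -/
theorem exists_longest_pair (G : MetricGraph V E) (hE : 2 ≤ Fintype.card E) :
    ∃ e₁ e₂, e₁ ≠ e₂ ∧ (∀ e, G.len e ≤ G.len e₁) ∧ ∀ e, e ≠ e₁ → G.len e ≤ G.len e₂ := by
  classical
  have : Nontrivial E := Fintype.one_lt_card_iff_nontrivial.1 hE
  obtain ⟨e₁, -, h₁⟩ := Finset.exists_max_image Finset.univ G.len Finset.univ_nonempty
  obtain ⟨e', he'⟩ := exists_ne e₁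
  obtain ⟨e₂, he₂, h₂⟩ := Finset.exists_max_image (Finset.univ.erase e₁) G.len
    ⟨e', Finset.mem_erase.2 ⟨he', Finset.mem_univ _⟩⟩
  exact ⟨e₁, e₂, (Finset.ne_of_mem_erase he₂).symm, fun e => h₁ e (Finset.mem_univ e),
    fun e he => h₂ e (Finset.mem_erase.2 ⟨he, Finset.mem_univ e⟩)⟩

theorem totalLength_le_of_longest_pair {e₁ e₂ : E} (h₂ : ∀ e, e ≠ e₁ → G.len e ≤ G.len e₂) :
    G.totalLength ≤ G.len e₁ + (Fintype.card E - 1) * G.len e₂ := by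
  classical
  rw [totalLength, ← Finset.add_sum_erase _ _ (Finset.mem_univ e₁)]
  have h := Finset.sum_le_card_nsmul (Finset.univ.erase e₁) G.len (G.len e₂) fun e he =>
    h₂ e (Finset.ne_of_mem_erase he)
  have : Nonempty E := ⟨e₁⟩
  rw [Finset.card_erase_of_mem (Finset.mem_univ e₁), Finset.card_univ, nsmul_eq_mul,
    Nat.cast_sub Fintype.card_pos, Nat.cast_one] at h
  linarith

theorem equilateral_of_card_mul_le {e₂ : E} (h : ∀ e, G.len e ≤ G.len e₂)
    (hL : Fintype.card E * G.len e₂ ≤ G.totalLength) : G.Equilateral := by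
  have h1 : ∑ e, G.len e = ∑ _e : E, G.len e₂ := by
    refine le_antisymm (Finset.sum_le_sum fun e _ => h e) ?_
    rw [Finset.sum_const, Finset.card_univ, nsmul_eq_mul]
    exact hL
  rw [Finset.sum_eq_sum_iff_of_le fun e _ => h e] at h1
  exact fun e e' => (h1 e (Finset.mem_univ e)).trans (h1 e' (Finset.mem_univ e')).symm

theorem spectralGap_eq_of_isPumpkin_or_isFlower (hG : G.IsPumpkin ∨ G.IsFlower)
    (hE : 2 ≤ Fintype.card E) (hleast : IsLeast G.posEigenvalues G.spectralGap)
    (hle : G.spectralGap ≤ Real.pi ^ 2 * (Fintype.card E : ℝ) ^ 2 / G.totalLength ^ 2)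
    (h : G.Equilateral ∨ Fintype.card E = 2) :
    G.spectralGap = Real.pi ^ 2 * (Fintype.card E : ℝ) ^ 2 / G.totalLength ^ 2 := by
  refine le_antisymm hle ?_
  by_contra! hlt
  obtain ⟨hpos, heig⟩ := hleast.1
  have hcard : 0 < Fintype.card E := by omega
  have : Nonempty E := Fintype.card_pos_iff.1 hcard
  have hL := G.totalLength_pos
  have hπ := Real.pi_pos
  rw [← mul_pow, ← div_pow, ← Real.sqrt_lt hpos.le (by positivity), lt_div_iff₀ hL] at hlt
  rw [← Real.sq_sqrt hpos.le] at heig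
  have hk := Real.sqrt_pos.2 hpos
  generalize √G.spectralGap = k at hlt heig hk
  have hc : (0 : ℝ) < Fintype.card E := by exact_mod_cast hcard
  rcases h with h | h
  · have hlen : ∀ e, k * G.len e < Real.pi := fun e => by
      have h1 : G.totalLength = Fintype.card E * G.len e := by
        rw [totalLength, Finset.sum_congr rfl fun e' _ => h e' e, Finset.sum_const,
          Finset.card_univ, nsmul_eq_mul]
      rw [h1] at hlt
      refine lt_of_mul_lt_mul_left (a := (Fintype.card E : ℝ)) ?_ hc.le
      linarith
    have e₀ : E := Classical.arbitrary E
    refine not_isEigenvalue_of_isPumpkin_or_isFlower hG hk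
      (Or.inl ⟨k * (G.len e₀ / 2), by linarith [hlen e₀], fun e => by rw [phase, h e e₀]⟩)
      (fun e => by linarith [hlen e]) heig
  · classical
    obtain ⟨e₁, e₂, hne, hu⟩ := Finset.card_eq_two.1 ((Finset.card_univ (α := E)).trans h)
    have hu' : ∀ e, e = e₁ ∨ e = e₂ := fun e => by
      simpa [hu] using Finset.mem_univ e
    rw [totalLength, hu, Finset.sum_pair hne, h, Nat.cast_ofNat] at hlt
    have h1 := mul_pos hk (G.len_pos e₁)
    have h2 := mul_pos hk (G.len_pos e₂)
    refine not_isEigenvalue_of_isPumpkin_or_isFlower hG hk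
      (Or.inr ⟨e₁, e₂, hne, hu', by simp only [phase]; linarith⟩) (fun e => ?_) heig
    rcases hu' e with rfl | rfl <;> linarith

theorem spectralGap_of_two_le_card (hG : G.Connected) (hE : 2 ≤ Fintype.card E) :
    IsLeast G.posEigenvalues G.spectralGap ∧
    G.spectralGap ≤ Real.pi ^ 2 * (Fintype.card E : ℝ) ^ 2 / G.totalLength ^ 2 ∧
    (G.spectralGap = Real.pi ^ 2 * (Fintype.card E : ℝ) ^ 2 / G.totalLength ^ 2 →
      (Fintype.card E = 2 ∨ G.Equilateral) ∧ (G.IsPumpkin ∨ G.IsFlower)) := by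
  obtain ⟨e₁, e₂, hne, h₁, h₂⟩ := G.exists_longest_pair hE
  have : Nonempty E := ⟨e₁⟩
  have hπ := Real.pi_pos
  have hL := G.totalLength_pos
  have hlpos := G.len_pos
  have hN : (2 : ℝ) ≤ Fintype.card E := by exact_mod_cast hE
  have htot := totalLength_le_of_longest_pair h₂
  obtain ⟨hleast, hle, heq⟩ := spectralGap_le_of_longest hG hne h₁
  -- The slack over `htot` is `(E / 2 - 1) (len e₁ - len e₂)`: zero for `E = 2`, and forcing `len e₁
  -- = len e₂` in the equality case for `E ≥ 3`.
  have hkey : G.totalLength ≤ Fintype.card E * (G.len e₁ + G.len e₂) / 2 := by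
    nlinarith [h₁ e₂]
  have hK : 2 * Real.pi / (G.len e₁ + G.len e₂) ≤
      Real.pi * Fintype.card E / G.totalLength := by
    rw [div_le_div_iff₀ (add_pos (hlpos _) (hlpos _)) hL]
    nlinarith
  rw [← mul_pow, ← div_pow]
  have hK0 : 0 < 2 * Real.pi / (G.len e₁ + G.len e₂) :=
    div_pos (by positivity) (add_pos (hlpos _) (hlpos _))
  refine ⟨hleast, hle.trans (pow_le_pow_left₀ hK0.le hK 2), fun hgap => ?_⟩
  have hKeq : 2 * Real.pi / (G.len e₁ + G.len e₂) = Real.pi * Fintype.card E / G.totalLength :=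
    hK.antisymm (le_of_sq_le_sq (hgap ▸ hle) hK0.le)
  have hLeq : G.totalLength = Fintype.card E * (G.len e₁ + G.len e₂) / 2 := by
    rw [div_eq_div_iff (add_pos (hlpos _) (hlpos _)).ne' hL.ne'] at hKeq
    apply mul_left_cancel₀ hπ.ne'
    linarith
  rcases hE.eq_or_lt with hE2 | hE3
  · refine ⟨Or.inl hE2.symm, ?_⟩
    have hu : ∀ e, e = e₁ ∨ e = e₂ := by
      classical
      have : ({e₁, e₂} : Finset E) = Finset.univ :=
        Finset.eq_univ_of_card _ (by rw [Finset.card_pair hne, hE2])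
      intro e
      simpa [← this] using Finset.mem_univ e
    have hends := heq (by rw [hgap, hKeq]) (Or.inr hu)
    refine hG.isPumpkin_or_isFlower (v := G.src e₁) (w := G.tgt e₁) fun e => ?_
    rcases hu e with rfl | rfl
    · exact Or.inl ⟨rfl, rfl⟩
    · exact hends
  · have hN3 : (3 : ℝ) ≤ Fintype.card E := by exact_mod_cast hE3
    have hl : G.len e₁ = G.len e₂ := by
      refine le_antisymm ?_ (h₁ e₂)
      nlinarith
    have hequi : G.Equilateral :=
      equilateral_of_card_mul_le (e₂ := e₁) h₁ (by rw [hLeq, ← hl]; linarith)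
    refine ⟨Or.inr hequi,
      hG.isPumpkin_or_isFlower (v := G.src e₁) (w := G.tgt e₁) fun e => ?_⟩
    rcases eq_or_ne e₁ e with rfl | hne'
    · exact Or.inl ⟨rfl, rfl⟩
    -- As all lengths agree, any other edge can play the role of `e₂`.
    · obtain ⟨-, -, h⟩ := spectralGap_le_of_longest hG hne' h₁
      exact h (by rw [hgap, ← hKeq, hequi e e₂]) (Or.inl (hequi e₁ e))

end MetricGraph

open MetricGraph in
theorem mainTheorem1 {V E : Type*} [Fintype E] (G : MetricGraph V E) (hG : G.Connected)
    (hE : 1 ≤ Fintype.card E) :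
    -- `spectralGap` really is a least positive eigenvalue, not a conventional value
    IsLeast G.posEigenvalues G.spectralGap ∧
    -- the upper bound
    (2 ≤ Fintype.card E →
      G.spectralGap ≤ Real.pi ^ 2 * (Fintype.card E : ℝ) ^ 2 / G.totalLength ^ 2) ∧
    -- the case of equality
    (3 ≤ Fintype.card E →
      (G.spectralGap = Real.pi ^ 2 * (Fintype.card E : ℝ) ^ 2 / G.totalLength ^ 2 ↔
        G.Equilateral ∧ (G.IsPumpkin ∨ G.IsFlower))) ∧
    (Fintype.card E = 2 →
      (G.spectralGap = Real.pi ^ 2 * (Fintype.card E : ℝ) ^ 2 / G.totalLength ^ 2 ↔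
        G.IsPumpkin ∨ G.IsFlower)) ∧
    -- a single edge: a loop or a path
    (Fintype.card E = 1 →
      ((∀ e, G.src e = G.tgt e) → G.spectralGap = 4 * Real.pi ^ 2 / G.totalLength ^ 2) ∧
      ((∀ e, G.src e ≠ G.tgt e) → G.spectralGap = Real.pi ^ 2 / G.totalLength ^ 2)) := by
  rcases hE.eq_or_lt with hE1 | hE2
  · obtain ⟨e₀, he₀⟩ := Fintype.card_eq_one_iff.1 hE1.symm
    have hL : G.totalLength = G.len e₀ := by
      have hu : (Finset.univ : Finset E) = {e₀} := by ext e; simpa using he₀ e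
      rw [totalLength, hu, Finset.sum_singleton]
    refine ⟨?_, fun h => by omega, fun h => by omega, fun h => by omega,
      fun _ => ⟨fun h => ?_, fun h => ?_⟩⟩
    · by_cases h : G.src e₀ = G.tgt e₀
      · have := isLeast_of_single_loop hG he₀ h
        rwa [← this.csInf_eq] at this
      · have := isLeast_of_single_path hG he₀ h
        rwa [← this.csInf_eq] at this
    · rw [hL, spectralGap, (isLeast_of_single_loop hG he₀ (h e₀)).csInf_eq, div_pow, mul_pow]
      norm_num
    · rw [hL, spectralGap, (isLeast_of_single_path hG he₀ (h e₀)).csInf_eq, div_pow]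
  · obtain ⟨hleast, hle, heq⟩ := spectralGap_of_two_le_card hG hE2
    refine ⟨hleast, fun _ => hle, fun h => ⟨fun h' => ?_, fun h' => ?_⟩,
      fun h => ⟨fun h' => (heq h').2, fun h' => ?_⟩, fun h => by omega⟩
    · exact ⟨(heq h').1.resolve_left (by omega), (heq h').2⟩
    · exact spectralGap_eq_of_isPumpkin_or_isFlower h'.2 hE2 hleast hle (Or.inl h'.1)
    · exact spectralGap_eq_of_isPumpkin_or_isFlower h' hE2 hleast hle (Or.inr h)
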